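/- Let $(X,\omega)$ be a compact Kähler manifold, let $\mathcal E$ be a holomorphic vector bundle of finite rank over $X$, and let $\phi$ be a holomorphic section of $\mathcal E$. For a smooth Hermitian metric $H$ on $\mathcal E$ let $F_H$ denote the curvature of its Chern connection (the connection compatible with $H$ and with the holomorphic structure), let $\Lambda$ denote the contraction of two-forms with $\omega$, and for a section $\psi$ of $\mathcal E$ let $\psi\otimes\psi^{*_H}$ denote the endomorphism $s\mapsto H(s,\psi)\,\psi$ (with $H$ linear in its first argument). For a smooth function $f\colon X\to\mathbb R$ and a smooth section $\psi$, not necessarily holomorphic, say that $H$ satisfies the $f$-vortex equation for the pair $(\mathcal E,\psi)$ if $$ i\Lambda F_H+\psi\otimes\psi^{*_H}=f\,\mathbf I . $$ Let $t\in C^\infty(X,\mathbb R)$ and $\tau\in\mathbb R$, and let $u\in C^\infty(X,\mathbb R)$ satisfy $\Delta u=\tau-t$, where $\Delta u=i\Lambda\bar\partial\partial u$ (equal to $\bar\partial^*\bar\partial u$, half of the non-negative Laplacian $d^*du$). Put $\phi_u=e^{-u/2}\phi$. Then $(\mathcal E,\phi)$ admits a smooth Hermitian metric $H$ satisfying the $t$-vortex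 equation if and only if $(\mathcal E,\phi_u)$ admits a smooth Hermitian metric $K$ satisfying the $\tau$-vortex equation. Moreover the metrics are related by $K=He^u$: the map $H\mapsto He^u$ is a bijection from the set of metrics satisfying the $t$-vortex equation for $(\mathcal E,\phi)$ onto the set of metrics satisfying the $\tau$-vortex equation for $(\mathcal E,\phi_u)$. -/

import Mathlib

open scoped Manifold ContDiff Topology Bundle

noncomputable section VortexDefs

/-! ### Calculus in a complex vector space

Real derivatives of complex-valued functions on a complex vector space, and their type
decomposition. A differential one-form (two-form) is written as a function of a point and of one
(two) tangent vectors. -/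

section LocalCalculus

variable {V : Type*} [NormedAddCommGroup V] [NormedSpace ℂ V]

/-- `∂f (v) = (1/2) (D_v f - i D_{iv} f)`. -/
def del (f : V → ℂ) (z v : V) : ℂ :=
  (1 / 2 : ℂ) * (fderiv ℝ f z v - Complex.I * fderiv ℝ f z (Complex.I • v))

/-- `∂̄f (v) = (1/2) (D_v f + i D_{iv} f)`. -/
def delbar (f : V → ℂ) (z v : V) : ℂ :=
  (1 / 2 : ℂ) * (fderiv ℝ f z v + Complex.I * fderiv ℝ f z (Complex.I • v))

/-- The `(1,1)`-form `∂̄∂f`, that is `∂̄α (v, w) = ∂̄_v (α(w)) - ∂̄_w (α(v))` for `α = ∂f`. -/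
def delbarDel (f : V → ℂ) (z v w : V) : ℂ :=
  delbar (fun z' => del f z' w) z v - delbar (fun z' => del f z' v) z w

/-- The curvature `dA + A ∧ A` of the connection `d + A`, for a matrix-valued one-form `A`:
`(dA + A ∧ A)(v, w) = D_v (A(w)) - D_w (A(v)) + A(v) A(w) - A(w) A(v)`. -/
def matrixCurvature {ι : Type*} [Fintype ι] (A : V → V → Matrix ι ι ℂ) (z v w : V) :
    Matrix ι ι ℂ :=
  Matrix.of (fun i j =>
      fderiv ℝ (fun z' => A z' w i j) z v - fderiv ℝ (fun z' => A z' v i j) z w)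
    + (A z v * A z w - A z w * A z v)

end LocalCalculus

/-! ### Hermitian metrics on holomorphic vector bundles -/

section Metrics

variable {B : Type*} [NormedAddCommGroup B] [NormedSpace ℂ B]
  {X : Type*} [TopologicalSpace X] [ChartedSpace B X]

/-- A smooth Hermitian metric on a complex vector bundle `E` with typical fibre `F` over a complex
manifold `X` modelled on `B`. The metric is conjugate linear in its first argument and linear in
its second one. Smoothness (over the reals) is that of the coefficients of the metric in the local
frames given by the local trivializations of `E`. -/
structure HermitianMetric (B : Type*) [NormedAddCommGroup B] [NormedSpace ℂ B]
    {X : Type*} [TopologicalSpace X] [ChartedSpace B X]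
    (F : Type*) [NormedAddCommGroup F] [NormedSpace ℂ F]
    (E : X → Type*) [∀ x, AddCommGroup (E x)] [∀ x, Module ℂ (E x)]
    [∀ x, TopologicalSpace (E x)] [TopologicalSpace (Bundle.TotalSpace F E)]
    [FiberBundle F E] where
  form : ∀ x, E x →ₗ⋆[ℂ] E x →ₗ[ℂ] ℂ
  conj_symm : ∀ x (v w : E x), (starRingEnd ℂ) (form x v w) = form x w v
  pos : ∀ x (v : E x), v ≠ 0 → 0 < (form x v v).re
  smooth : ∀ (e : Bundle.Trivialization F (Bundle.TotalSpace.proj : Bundle.TotalSpace F E → X))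
    [MemTrivializationAtlas e] (a b : F),
    ContMDiffOn 𝓘(ℝ, B) 𝓘(ℝ, ℂ) ∞ (fun x => form x (e.symm x a) (e.symm x b)) e.baseSet

namespace HermitianMetric

variable {F : Type*} [NormedAddCommGroup F] [NormedSpace ℂ F]
  {E : X → Type*} [∀ x, AddCommGroup (E x)] [∀ x, Module ℂ (E x)]
  [∀ x, TopologicalSpace (E x)] [TopologicalSpace (Bundle.TotalSpace F E)]
  [FiberBundle F E]

/-- The metric `H e^u`, for a smooth real-valued function `u`. -/
def mulExp (H : HermitianMetric B F E) (u : X → ℝ) (hu : ContMDiff 𝓘(ℝ, B) 𝓘(ℝ, ℝ) ∞ u) :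
    HermitianMetric B F E where
  form x := ((Real.exp (u x) : ℝ) : ℂ) • H.form x
  conj_symm x v w := by
    simp only [LinearMap.smul_apply, smul_eq_mul, map_mul, Complex.conj_ofReal, H.conj_symm]
  pos x v hv := by
    simp only [LinearMap.smul_apply, smul_eq_mul, Complex.re_ofReal_mul]
    exact mul_pos (Real.exp_pos _) (H.pos x v hv)
  smooth e _ a b := by
    have h1 : ContMDiff 𝓘(ℝ, B) 𝓘(ℝ, ℂ) ∞ (fun x => ((Real.exp (u x) : ℝ) : ℂ)) :=
      (Complex.ofRealCLM.contDiff.comp Real.contDiff_exp).contMDiff.comp hu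
    have h2 := H.smooth e a b
    have h3 : ContDiff ℝ ∞ (fun p : ℂ × ℂ => p.1 * p.2) := contDiff_fst.mul contDiff_snd
    exact h3.contMDiff.comp_contMDiffOn (h1.contMDiffOn.prodMk_space h2)

/-- The coefficients of the metric near `x₀`, in the preferred chart of `X` at `x₀` and the
preferred local trivialization of `E` at `x₀`. -/
def localForm (H : HermitianMetric B F E) (x₀ : X) (z : B) (a b : F) : ℂ :=
  H.form ((chartAt B x₀).symm z)
    ((trivializationAt F E x₀).symm ((chartAt B x₀).symm z) a)
    ((trivializationAt F E x₀).symm ((chartAt B x₀).symm z) b)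

variable [FiniteDimensional ℂ F]

/-- The Gram matrix `h` of the metric in the local frame that the preferred local trivialization
of `E` at `x₀` defines, as a function of the coordinates. -/
def gram (H : HermitianMetric B F E) (x₀ : X) (z : B) :
    Matrix (Fin (Module.finrank ℂ F)) (Fin (Module.finrank ℂ F)) ℂ :=
  Matrix.of fun i j => H.localForm x₀ z (Module.finBasis ℂ F i) (Module.finBasis ℂ F j)

/-- The connection one-form `h⁻¹ ∂h` of the Chern connection (the connection compatible with the
metric and with the holomorphic structure) in a local holomorphic frame near `x₀`. -/
def chernForm (H : HermitianMetric B F E) (x₀ : X) (z v : B) :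
    Matrix (Fin (Module.finrank ℂ F)) (Fin (Module.finrank ℂ F)) ℂ :=
  (H.gram x₀ z)⁻¹ * Matrix.of (fun i j => del (fun z' => H.gram x₀ z' i j) z v)

/-- The curvature `F_H` at `x` of the Chern connection, evaluated on the tangent vectors with
coordinates `v` and `w` in the preferred chart at `x`, as an endomorphism of the fibre. -/
def curvature [VectorBundle ℂ F E] (H : HermitianMetric B F E) (x : X) (v w : B) :
    E x →ₗ[ℂ] E x :=
  ((trivializationAt F E x).continuousLinearEquivAt ℂ x
      (FiberBundle.mem_baseSet_trivializationAt' x)).symm.toLinearEquiv.conj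
    (Matrix.toLin (Module.finBasis ℂ F) (Module.finBasis ℂ F)
      (matrixCurvature (H.chernForm x) (chartAt B x x) v w))

end HermitianMetric

end Metrics

/-! ### Kähler metrics, the contraction `Λ` and the Laplacian -/

section Kaehler

variable {B : Type*} [NormedAddCommGroup B] [NormedSpace ℂ B]
  {X : Type*} [TopologicalSpace X] [ChartedSpace B X] [IsManifold 𝓘(ℂ, B) ω X]

/-- The fundamental two-form `ω = Im h` of a Hermitian metric `h` on the tangent bundle, in the
preferred chart at `x₀`. It satisfies `ω(v, iw) = Re h(v, w)`. -/
def fundamentalForm (h : HermitianMetric B B (TangentSpace 𝓘(ℂ, B) : X → Type _))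
    (x₀ : X) (z v w : B) : ℝ :=
  (h.localForm x₀ z v w).im

/-- A Kähler metric on a complex manifold: a Hermitian metric on the holomorphic tangent bundle
whose fundamental two-form is closed. -/
structure KaehlerMetric (B : Type*) [NormedAddCommGroup B] [NormedSpace ℂ B]
    (X : Type*) [TopologicalSpace X] [ChartedSpace B X] [IsManifold 𝓘(ℂ, B) ω X]
    extends HermitianMetric B B (TangentSpace 𝓘(ℂ, B) : X → Type _) where
  closed : ∀ (x : X) (a b c : B),
    fderiv ℝ (fun z => fundamentalForm toHermitianMetric x z b c) (chartAt B x x) a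
    + fderiv ℝ (fun z => fundamentalForm toHermitianMetric x z c a) (chartAt B x x) b
    + fderiv ℝ (fun z => fundamentalForm toHermitianMetric x z a b) (chartAt B x x) c = 0

namespace KaehlerMetric

variable [FiniteDimensional ℂ B]

/-- The Gram matrix at `x` of the Riemannian metric `Re h`, in a real basis of the tangent space. -/
def realGram (g : KaehlerMetric B X) (x : X) :
    Matrix (Fin (Module.finrank ℝ B)) (Fin (Module.finrank ℝ B)) ℝ :=
  Matrix.of fun a b =>
    (g.localForm x (chartAt B x x) (Module.finBasis ℝ B a) (Module.finBasis ℝ B b)).re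

/-- The contraction `Λα = (1/2) ∑ g^{ab} α(e_a, i e_b)` at `x` of a two-form `α` (with values in a
complex vector space) with the Kähler form. In a unitary basis `ε_1, …, ε_n` of the tangent space it
is `∑_j α(ε_j, i ε_j)`, and `Λω = n`. -/
def contract {M : Type*} [AddCommGroup M] [Module ℂ M] (g : KaehlerMetric B X) (x : X)
    (α : B → B → M) : M :=
  (1 / 2 : ℂ) • ∑ a, ∑ b, (((g.realGram x)⁻¹ a b : ℝ) : ℂ) •
    α (Module.finBasis ℝ B a) (Complex.I • Module.finBasis ℝ B b)

/-- The Laplacian `Δu = iΛ∂̄∂u` of a real-valued function `u`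
(which is `∂̄^*∂̄u`, half of the non-negative Laplacian `d^*du`). -/
def laplacian (g : KaehlerMetric B X) (u : X → ℝ) (x : X) : ℂ :=
  Complex.I * g.contract x
    (delbarDel (fun z => ((u ((chartAt B x).symm z) : ℝ) : ℂ)) (chartAt B x x))

end KaehlerMetric

end Kaehler

/-! ### The vortex equation -/

section Vortex

variable {B : Type*} [NormedAddCommGroup B] [NormedSpace ℂ B] [FiniteDimensional ℂ B]
  {X : Type*} [TopologicalSpace X] [ChartedSpace B X] [IsManifold 𝓘(ℂ, B) ω X]
  {F : Type*} [NormedAddCommGroup F] [NormedSpace ℂ F] [FiniteDimensional ℂ F]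
  {E : X → Type*} [∀ x, AddCommGroup (E x)] [∀ x, Module ℂ (E x)]
  [∀ x, TopologicalSpace (E x)] [TopologicalSpace (Bundle.TotalSpace F E)]
  [FiberBundle F E] [VectorBundle ℂ F E]

/-- The metric `H` solves the `t`-vortex equation `iΛF_H + ψ ⊗ ψ^{*_H} = t I` for the pair `(E, ψ)`.
Here `ψ ⊗ ψ^{*_H}` is the endomorphism `s ↦ H(ψ, s) ψ`. -/
def SolvesVortex (g : KaehlerMetric B X) (ψ : ∀ x, E x) (t : X → ℝ)
    (H : HermitianMetric B F E) : Prop :=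
  ∀ (x : X) (s : E x),
    (Complex.I • g.contract x (H.curvature x)) s + H.form x (ψ x) s • ψ x = ((t x : ℝ) : ℂ) • s

/-- The section `φ_u = e^{-u/2} φ`. -/
def twistSection (u : X → ℝ) (φ : ∀ x, E x) : ∀ x, E x :=
  fun x => ((Real.exp (-(u x) / 2) : ℝ) : ℂ) • φ x

end Vortex

end VortexDefs

/-!
The conformal change `K = H e^u` intertwines the two vortex equations, metric by metric.

In a local holomorphic frame let `h` be the Gram matrix of `H`. That of `H e^u` is `e^u h`, so the
Chern connection form changes by a scalar,
`(e^u h)⁻¹ ∂(e^u h) = h⁻¹ ∂h + ∂u · 1` (`chernForm_mulExp`). A scalar summand commutes with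
everything and hence drops out of the quadratic part of the curvature, and since `∂∂u = 0`, by the
symmetry of second derivatives (`fderiv_del_sub_fderiv_del`), the curvature changes by
`d∂u = ∂̄∂u` times the identity (`curvature_mulExp`). Contracting with the Kähler form gives
`iΛF_K = iΛF_H + Δu · 1 = iΛF_H + (τ - t) · 1`. On the other hand the factor `e^u` in `K` cancels
the two factors `e^{-u/2}` in `φ_u`, so `φ_u ⊗ φ_u^{*_K} = φ ⊗ φ^{*_H}`. Therefore `H` solves
the `t`-vortex equation for `φ` precisely when `K` solves the `τ`-vortex equation for `φ_u`
(`solvesVortex_mulExp_iff`). As `H ↦ H e^u` has the inverse `K ↦ K e^{-u}` on the set of all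
Hermitian metrics, the bijection follows.

Since Lean's derivatives are total, the computation needs that the coefficients of `H` are smooth
near the centre of the chart and that `h` is invertible there (`contDiffAt_gram`,
`isUnit_det_gram`); these follow from the smoothness and positivity of `H`.
-/

/-! ### The operators `∂` and `∂̄` -/

section LocalLemmas

variable {V : Type*} [NormedAddCommGroup V] [NormedSpace ℂ V]

theorem del_mul {f g : V → ℂ} {z : V} (hf : DifferentiableAt ℝ f z)
    (hg : DifferentiableAt ℝ g z) (v : V) :
    del (fun z' => f z' * g z') z v = f z * del g z v + g z * del f z v := by
  have h : fderiv ℝ (fun z' => f z' * g z') z = f z • fderiv ℝ g z + g z • fderiv ℝ f z :=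
    fderiv_fun_mul hf hg
  simp only [del, h, _root_.add_apply, _root_.smul_apply, smul_eq_mul]
  ring

theorem del_cexp {f : V → ℂ} {z : V} (hf : DifferentiableAt ℝ f z) (v : V) :
    del (fun z' => Complex.exp (f z')) z v = Complex.exp (f z) * del f z v := by
  have h : fderiv ℝ (fun z' => Complex.exp (f z')) z = Complex.exp (f z) • fderiv ℝ f z :=
    hf.hasFDerivAt.cexp.fderiv
  simp only [del, h, _root_.smul_apply, smul_eq_mul]
  ring

theorem ContDiffAt.fderiv_apply_const {f : V → ℂ} {z : V} (hf : ContDiffAt ℝ ∞ f z) (v : V) :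
    ContDiffAt ℝ ∞ (fun z' => fderiv ℝ f z' v) z :=
  (hf.fderiv_right (m := ∞) (by simp)).clm_apply contDiffAt_const

theorem ContDiffAt.del {f : V → ℂ} {z : V} (hf : ContDiffAt ℝ ∞ f z) (v : V) :
    ContDiffAt ℝ ∞ (fun z' => del f z' v) z :=
  contDiffAt_const.mul ((hf.fderiv_apply_const v).sub
    (contDiffAt_const.mul (hf.fderiv_apply_const (Complex.I • v))))

theorem fderiv_del {f : V → ℂ} {z : V} (hf : ContDiffAt ℝ ∞ f z) (v w : V) :
    fderiv ℝ (fun z' => del f z' w) z v = (1 / 2 : ℂ) *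
      (fderiv ℝ (fderiv ℝ f) z v w - Complex.I * fderiv ℝ (fderiv ℝ f) z v (Complex.I • w)) := by
  have hd : DifferentiableAt ℝ (fderiv ℝ f) z :=
    (hf.fderiv_right (m := ∞) (by simp)).differentiableAt (by simp)
  have h1 : ∀ a : V, HasFDerivAt (fun z' => fderiv ℝ f z' a)
      ((fderiv ℝ (fderiv ℝ f) z).flip a) z := fun a => by
    simpa using hd.hasFDerivAt.clm_apply (hasFDerivAt_const a z)
  have h2 : HasFDerivAt (fun z' => _root_.del f z' w) _ z :=
    ((h1 w).sub ((h1 (Complex.I • w)).const_mul Complex.I)).const_mul (1 / 2 : ℂ)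
  rw [h2.fderiv]
  simp

/-- The identity `d∂f = ∂̄∂f`, equivalently `∂∂f = 0`. -/
theorem fderiv_del_sub_fderiv_del {f : V → ℂ} {z : V} (hf : ContDiffAt ℝ ∞ f z) (v w : V) :
    fderiv ℝ (fun z' => del f z' w) z v - fderiv ℝ (fun z' => del f z' v) z w
      = delbarDel f z v w := by
  have hs : IsSymmSndFDerivAt ℝ f z :=
    hf.isSymmSndFDerivAt (by simpa using WithTop.coe_le_coe.2 (le_top (a := (2 : ℕ∞))))
  simp only [delbarDel, delbar, fderiv_del hf]
  rw [hs.eq w v, hs.eq w (Complex.I • v), hs.eq (Complex.I • w) v,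
    hs.eq (Complex.I • w) (Complex.I • v)]
  ring

/-! ### Smooth matrix-valued functions and curvature -/

variable {ι : Type*} [Fintype ι] [DecidableEq ι]

theorem contDiffAt_det {M : V → Matrix ι ι ℂ} {z : V}
    (hM : ∀ i j, ContDiffAt ℝ ∞ (fun z' => M z' i j) z) :
    ContDiffAt ℝ ∞ (fun z' => (M z').det) z := by
  simp only [Matrix.det_apply]
  refine ContDiffAt.sum fun σ _ => ContDiffAt.const_smul _ ?_
  exact contDiffAt_prod fun i _ => hM _ _

theorem contDiffAt_matrix_inv {M : V → Matrix ι ι ℂ} {z : V}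
    (hM : ∀ i j, ContDiffAt ℝ ∞ (fun z' => M z' i j) z) (hdet : IsUnit (M z).det) (i j : ι) :
    ContDiffAt ℝ ∞ (fun z' => (M z')⁻¹ i j) z := by
  have h1 : ContDiffAt ℝ ∞ (fun z' => (M z').adjugate i j) z := by
    simp only [Matrix.adjugate_apply]
    refine contDiffAt_det fun k l => ?_
    by_cases hk : k = j
    · subst hk
      simpa using contDiffAt_const
    · simpa [Matrix.updateRow_ne hk] using hM k l
  simp only [Matrix.inv_def, Matrix.smul_apply, smul_eq_mul, Ring.inverse_eq_inv']
  exact ((contDiffAt_det hM).inv hdet.ne_zero).mul h1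

/-- Adding a scalar one-form `a` to a connection form adds `da` to the curvature. -/
theorem matrixCurvature_add_scalar {A A' : V → V → Matrix ι ι ℂ} {a : V → V → ℂ} {z : V}
    (hA : ∀ v i j, DifferentiableAt ℝ (fun z' => A z' v i j) z)
    (ha : ∀ v, DifferentiableAt ℝ (fun z' => a z' v) z)
    (h : ∀ᶠ z' in 𝓝 z, ∀ v, A' z' v = A z' v + a z' v • (1 : Matrix ι ι ℂ)) (v w : V) :
    matrixCurvature A' z v w = matrixCurvature A z v w
      + (fderiv ℝ (fun z' => a z' w) z v - fderiv ℝ (fun z' => a z' v) z w)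
        • (1 : Matrix ι ι ℂ) := by
  have hD : ∀ (v w : V) (i j : ι), fderiv ℝ (fun z' => A' z' w i j) z v
      = fderiv ℝ (fun z' => A z' w i j) z v
        + fderiv ℝ (fun z' => a z' w) z v * (1 : Matrix ι ι ℂ) i j := fun v w i j => by
    have he : (fun z' => A' z' w i j) =ᶠ[𝓝 z]
        fun z' => A z' w i j + a z' w * (1 : Matrix ι ι ℂ) i j := by
      filter_upwards [h] with z' hz'
      simp [hz' w]
    have hd : HasFDerivAt (fun z' => A z' w i j + a z' w * (1 : Matrix ι ι ℂ) i j) _ z :=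
      (hA w i j).hasFDerivAt.add ((ha w).hasFDerivAt.mul_const ((1 : Matrix ι ι ℂ) i j))
    rw [he.fderiv_eq, hd.fderiv]
    simp [mul_comm]
  have hz := h.self_of_nhds
  have hc : A' z v * A' z w - A' z w * A' z v = A z v * A z w - A z w * A z v := by
    rw [hz v, hz w]
    simp only [add_mul, mul_add, smul_mul_assoc, mul_smul_comm, one_mul, mul_one, smul_add]
    rw [smul_comm (a z w) (a z v)]
    abel
  ext i j
  simp only [matrixCurvature, hc, hD, Matrix.add_apply, Matrix.of_apply, Matrix.smul_apply,
    smul_eq_mul]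
  ring

end LocalLemmas

/-! ### The Chern connection of a conformally rescaled metric -/

section MetricLemmas

variable {B : Type*} [NormedAddCommGroup B] [NormedSpace ℂ B]
  {X : Type*} [TopologicalSpace X] [ChartedSpace B X]

theorem contDiffAt_comp_chartAt_symm {G : Type*} [NormedAddCommGroup G] [NormedSpace ℝ G]
    {f : X → G} {x : X} (hf : ContMDiffAt 𝓘(ℝ, B) 𝓘(ℝ, G) ∞ f x) :
    ContDiffAt ℝ ∞ (fun z => f ((chartAt B x).symm z)) (chartAt B x x) := by
  have h := (contMDiffAt_iff.1 hf).2
  simpa [contDiffWithinAt_univ, Function.comp_def, chartAt_self_eq] using h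

theorem contDiffAt_ofReal_comp_chartAt_symm {u : X → ℝ}
    (hu : ContMDiff 𝓘(ℝ, B) 𝓘(ℝ, ℝ) ∞ u) (x : X) :
    ContDiffAt ℝ ∞ (fun z => ((u ((chartAt B x).symm z) : ℝ) : ℂ)) (chartAt B x x) :=
  Complex.ofRealCLM.contDiff.contDiffAt.comp _ (contDiffAt_comp_chartAt_symm (hu x))

namespace HermitianMetric

variable {F : Type*} [NormedAddCommGroup F] [NormedSpace ℂ F]
  {E : X → Type*} [∀ x, AddCommGroup (E x)] [∀ x, Module ℂ (E x)]
  [∀ x, TopologicalSpace (E x)] [TopologicalSpace (Bundle.TotalSpace F E)]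
  [FiberBundle F E]

theorem ext_form {H K : HermitianMetric B F E} (h : ∀ x v w, H.form x v w = K.form x v w) :
    H = K := by
  have : H.form = K.form := by
    funext x
    ext v w
    exact h x v w
  cases H
  cases K
  congr

theorem mulExp_form (H : HermitianMetric B F E) (u : X → ℝ)
    (hu : ContMDiff 𝓘(ℝ, B) 𝓘(ℝ, ℝ) ∞ u) (x : X) (v w : E x) :
    (H.mulExp u hu).form x v w = ((Real.exp (u x) : ℝ) : ℂ) * H.form x v w := rfl

theorem mulExp_mulExp_of_add_eq_zero (H : HermitianMetric B F E) {u v : X → ℝ}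
    (hu : ContMDiff 𝓘(ℝ, B) 𝓘(ℝ, ℝ) ∞ u) (hv : ContMDiff 𝓘(ℝ, B) 𝓘(ℝ, ℝ) ∞ v)
    (h : ∀ x, u x + v x = 0) : (H.mulExp u hu).mulExp v hv = H := by
  refine ext_form fun x a b => ?_
  rw [mulExp_form, mulExp_form, ← mul_assoc, ← Complex.ofReal_mul, ← Real.exp_add, add_comm, h x]
  simp

/-- The endomorphism `φ ⊗ φ^{*_H}` is unchanged when `(H, φ)` is replaced by
`(H e^u, e^{-u/2} φ)`. -/
theorem mulExp_form_twistSection (H : HermitianMetric B F E) (u : X → ℝ)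
    (hu : ContMDiff 𝓘(ℝ, B) 𝓘(ℝ, ℝ) ∞ u) (φ : ∀ x, E x) (x : X) (s : E x) :
    (H.mulExp u hu).form x (twistSection u φ x) s • twistSection u φ x
      = H.form x (φ x) s • φ x := by
  have h : Real.exp (u x) * Real.exp (-(u x) / 2) * Real.exp (-(u x) / 2) = 1 := by
    rw [← Real.exp_add, ← Real.exp_add, Real.exp_eq_one_iff]
    ring
  have h' := congrArg (fun r : ℝ => (r : ℂ)) h
  simp only [Complex.ofReal_mul, Complex.ofReal_one] at h'
  simp only [mulExp_form, twistSection, LinearMap.map_smulₛₗ,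
    LinearMap.smul_apply, Complex.conj_ofReal, smul_eq_mul, smul_smul]
  congr 1
  linear_combination H.form x (φ x) s * h'

variable [FiniteDimensional ℂ F]

theorem contDiffAt_gram (H : HermitianMetric B F E) (x : X)
    (i j : Fin (Module.finrank ℂ F)) :
    ContDiffAt ℝ ∞ (fun z => H.gram x z i j) (chartAt B x x) :=
  contDiffAt_comp_chartAt_symm
    ((H.smooth (trivializationAt F E x) (Module.finBasis ℂ F i) (Module.finBasis ℂ F j)).contMDiffAt
      ((trivializationAt F E x).open_baseSet.mem_nhds
        (FiberBundle.mem_baseSet_trivializationAt' x)))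

theorem gram_mulExp (H : HermitianMetric B F E) (u : X → ℝ)
    (hu : ContMDiff 𝓘(ℝ, B) 𝓘(ℝ, ℝ) ∞ u) (x : X) (z : B) :
    (H.mulExp u hu).gram x z
      = Complex.exp ((u ((chartAt B x).symm z) : ℝ) : ℂ) • H.gram x z := by
  ext i j
  simp [gram, localForm, mulExp_form, Complex.ofReal_exp]

/-- The Gram matrix is invertible at the centre of the chart, by positivity of the metric. -/
theorem isUnit_det_gram [VectorBundle ℂ F E] (H : HermitianMetric B F E) (x : X) :
    IsUnit (H.gram x (chartAt B x x)).det := by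
  rw [isUnit_iff_ne_zero]
  intro h0
  obtain ⟨c, hc, hc0⟩ := Matrix.exists_mulVec_eq_zero_iff.2 h0
  apply hc
  -- A vector `c` in the kernel of the Gram matrix would give `v = ∑ cᵢ eᵢ` with `H(v, v) = 0`,
  -- where `eᵢ = L bᵢ` is the frame at `x`.
  let L := ((trivializationAt F E x).continuousLinearEquivAt ℂ x
      (FiberBundle.mem_baseSet_trivializationAt' x)).symm
  have hx : (chartAt B x).symm (chartAt B x x) = x :=
    (chartAt B x).left_inv (mem_chart_source B x)
  have hg : ∀ i j, H.gram x (chartAt B x x) i j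
      = H.form x (L (Module.finBasis ℂ F i)) (L (Module.finBasis ℂ F j)) := fun i j => by
    simp only [gram, localForm, Matrix.of_apply]
    rw [hx]
    rfl
  let v := L (∑ i, c i • Module.finBasis ℂ F i)
  have hrow : ∀ i, H.form x (L (Module.finBasis ℂ F i)) v = 0 := fun i => by
    have := congrFun hc0 i
    simp only [Matrix.mulVec, dotProduct, hg, Pi.zero_apply] at this
    simp only [v, map_sum, map_smul, smul_eq_mul]
    rw [← this]
    exact Finset.sum_congr rfl fun j _ => mul_comm _ _
  have hvv : H.form x v v = 0 := by
    have hv : v = ∑ i, c i • L (Module.finBasis ℂ F i) := by simp [v]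
    conv_lhs => enter [1]; rw [hv]
    simp [hrow]
  have hv0 : v = 0 := by
    by_contra hne
    have := H.pos x v hne
    simp [hvv] at this
  have hs : ∑ i, c i • Module.finBasis ℂ F i = 0 :=
    (map_eq_zero_iff L L.injective).1 hv0
  funext i
  exact Fintype.linearIndependent_iff.1 (Module.finBasis ℂ F).linearIndependent c hs i

theorem contDiffAt_chernForm [VectorBundle ℂ F E] (H : HermitianMetric B F E) (x : X) (v : B)
    (i j : Fin (Module.finrank ℂ F)) :
    ContDiffAt ℝ ∞ (fun z => H.chernForm x z v i j) (chartAt B x x) := by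
  simp only [chernForm, Matrix.mul_apply, Matrix.of_apply]
  exact ContDiffAt.sum fun k _ =>
    (contDiffAt_matrix_inv (H.contDiffAt_gram x) (H.isUnit_det_gram x) i k).mul
      ((H.contDiffAt_gram x k j).del v)

/-- Rescaling the metric by `e^u` adds the scalar one-form `∂u` to the Chern connection form. -/
theorem chernForm_mulExp [VectorBundle ℂ F E] (H : HermitianMetric B F E) (u : X → ℝ)
    (hu : ContMDiff 𝓘(ℝ, B) 𝓘(ℝ, ℝ) ∞ u) (x : X) :
    ∀ᶠ z in 𝓝 (chartAt B x x), ∀ v, (H.mulExp u hu).chernForm x z v = H.chernForm x z v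
      + del (fun z' => ((u ((chartAt B x).symm z') : ℝ) : ℂ)) z v • 1 := by
  have hU := contDiffAt_ofReal_comp_chartAt_symm hu x
  have hUd := (hU.of_le (m := 1) (by simp)).eventually (by simp)
  have hHd : ∀ᶠ z in 𝓝 (chartAt B x x), ∀ i j,
      ContDiffAt ℝ 1 (fun z' => H.gram x z' i j) z := by
    simp only [Filter.eventually_all]
    exact fun i j => ((H.contDiffAt_gram x i j).of_le (m := 1) (by simp)).eventually (by simp)
  have hdet : ∀ᶠ z in 𝓝 (chartAt B x x), (H.gram x z).det ≠ 0 :=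
    (contDiffAt_det (H.contDiffAt_gram x)).continuousAt.eventually_ne
      (H.isUnit_det_gram x).ne_zero
  filter_upwards [hUd, hHd, hdet] with z hz1 hz2 hz3 v
  have hz1' := hz1.differentiableAt one_ne_zero
  have hdel : Matrix.of (fun i j => del (fun z' => (H.mulExp u hu).gram x z' i j) z v)
      = Complex.exp ((u ((chartAt B x).symm z) : ℝ) : ℂ) •
        (Matrix.of (fun i j => del (fun z' => H.gram x z' i j) z v)
          + del (fun z' => ((u ((chartAt B x).symm z') : ℝ) : ℂ)) z v • H.gram x z) := by
    ext i j
    simp only [gram_mulExp, Matrix.of_apply, Matrix.smul_apply, Matrix.add_apply, smul_eq_mul]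
    rw [del_mul hz1'.cexp ((hz2 i j).differentiableAt one_ne_zero), del_cexp hz1']
    ring
  have hinv : ((H.mulExp u hu).gram x z)⁻¹
      = (Complex.exp ((u ((chartAt B x).symm z) : ℝ) : ℂ))⁻¹ • (H.gram x z)⁻¹ := by
    rw [gram_mulExp]
    exact Matrix.inv_smul' _ (Units.mk0 _ (Complex.exp_ne_zero _)) (isUnit_iff_ne_zero.2 hz3)
  -- The factors `e^{-u}` and `e^u` cancel, and so do `h⁻¹` and `h` in the term containing `∂u`.
  rw [chernForm, chernForm, hdel, hinv, smul_mul_smul_comm, inv_mul_cancel₀ (Complex.exp_ne_zero _),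
    one_smul, mul_add, mul_smul_comm, Matrix.nonsing_inv_mul _ (isUnit_iff_ne_zero.2 hz3)]

/-- Rescaling the metric by `e^u` adds `∂̄∂u` times the identity to the curvature. -/
theorem curvature_mulExp [VectorBundle ℂ F E] (H : HermitianMetric B F E) (u : X → ℝ)
    (hu : ContMDiff 𝓘(ℝ, B) 𝓘(ℝ, ℝ) ∞ u) (x : X) (v w : B) :
    (H.mulExp u hu).curvature x v w = H.curvature x v w
      + delbarDel (fun z => ((u ((chartAt B x).symm z) : ℝ) : ℂ)) (chartAt B x x) v w
        • LinearMap.id := by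
  have hU := contDiffAt_ofReal_comp_chartAt_symm hu x
  rw [curvature, curvature, matrixCurvature_add_scalar
    (fun v i j => (H.contDiffAt_chernForm x v i j).differentiableAt (by simp))
    (fun v => (hU.del v).differentiableAt (by simp)) (H.chernForm_mulExp u hu x),
    fderiv_del_sub_fderiv_del hU, map_add, map_add, map_smul, map_smul, Matrix.toLin_one,
    LinearEquiv.conj_id]

end HermitianMetric

end MetricLemmas

/-! ### The vortex equation under conformal rescaling -/

section VortexLemmas

variable {B : Type*} [NormedAddCommGroup B] [NormedSpace ℂ B] [FiniteDimensional ℂ B]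
  {X : Type*} [TopologicalSpace X] [ChartedSpace B X] [IsManifold 𝓘(ℂ, B) ω X]

theorem KaehlerMetric.contract_add_smul {M : Type*} [AddCommGroup M] [Module ℂ M]
    (g : KaehlerMetric B X) (x : X) (α : B → B → M) (β : B → B → ℂ) (m : M) :
    g.contract x (fun v w => α v w + β v w • m) = g.contract x α + g.contract x β • m := by
  simp only [KaehlerMetric.contract, smul_add, Finset.sum_add_distrib, smul_eq_mul, mul_smul,
    Finset.sum_smul]

variable {F : Type*} [NormedAddCommGroup F] [NormedSpace ℂ F] [FiniteDimensional ℂ F]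
  {E : X → Type*} [∀ x, AddCommGroup (E x)] [∀ x, Module ℂ (E x)]
  [∀ x, TopologicalSpace (E x)] [TopologicalSpace (Bundle.TotalSpace F E)]
  [FiberBundle F E] [VectorBundle ℂ F E]

theorem solvesVortex_mulExp_iff (g : KaehlerMetric B X) (φ : ∀ x, E x) (t : X → ℝ) (τ : ℝ)
    (u : X → ℝ) (hu : ContMDiff 𝓘(ℝ, B) 𝓘(ℝ, ℝ) ∞ u)
    (hΔ : ∀ x, g.laplacian u x = ((τ - t x : ℝ) : ℂ)) (H : HermitianMetric B F E) :
    SolvesVortex g (twistSection u φ) (fun _ => τ) (H.mulExp u hu) ↔ SolvesVortex g φ t H := by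
  refine forall₂_congr fun x s => ?_
  have hcurv : (Complex.I • g.contract x ((H.mulExp u hu).curvature x)) s
      = (Complex.I • g.contract x (H.curvature x)) s + ((τ - t x : ℝ) : ℂ) • s := by
    have h : (H.mulExp u hu).curvature x = fun v w => H.curvature x v w
        + delbarDel (fun z => ((u ((chartAt B x).symm z) : ℝ) : ℂ)) (chartAt B x x) v w
          • LinearMap.id := by
      funext v w
      exact H.curvature_mulExp u hu x v w
    rw [h, g.contract_add_smul, smul_add, smul_smul, ← hΔ x]
    rfl
  rw [hcurv, H.mulExp_form_twistSection, add_right_comm, Complex.ofReal_sub, sub_smul,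
    ← eq_sub_iff_add_eq, sub_sub_cancel]

end VortexLemmas

theorem mainTheorem7
    {B : Type*} [NormedAddCommGroup B] [NormedSpace ℂ B] [FiniteDimensional ℂ B]
    {X : Type*} [TopologicalSpace X] [T2Space X] [CompactSpace X] [ChartedSpace B X]
    [IsManifold 𝓘(ℂ, B) ω X] (g : KaehlerMetric B X)
    {F : Type*} [NormedAddCommGroup F] [NormedSpace ℂ F] [FiniteDimensional ℂ F]
    {E : X → Type*} [∀ x, AddCommGroup (E x)] [∀ x, Module ℂ (E x)]
    [∀ x, TopologicalSpace (E x)] [TopologicalSpace (Bundle.TotalSpace F E)]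
    [FiberBundle F E] [VectorBundle ℂ F E] [ContMDiffVectorBundle ω F E 𝓘(ℂ, B)]
    (φ : ∀ x, E x)
    (hφ : MDifferentiable 𝓘(ℂ, B) (𝓘(ℂ, B).prod 𝓘(ℂ, F))
      (fun x => Bundle.TotalSpace.mk' F x (φ x)))
    (t : X → ℝ) (ht : ContMDiff 𝓘(ℝ, B) 𝓘(ℝ, ℝ) ∞ t) (τ : ℝ)
    (u : X → ℝ) (hu : ContMDiff 𝓘(ℝ, B) 𝓘(ℝ, ℝ) ∞ u)
    (hΔ : ∀ x, g.laplacian u x = ((τ - t x : ℝ) : ℂ)) :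
    ((∃ H : HermitianMetric B F E, SolvesVortex g φ t H) ↔
      (∃ K : HermitianMetric B F E, SolvesVortex g (twistSection u φ) (fun _ => τ) K)) ∧
    Set.BijOn (fun H : HermitianMetric B F E => H.mulExp u hu)
      {H | SolvesVortex g φ t H}
      {K | SolvesVortex g (twistSection u φ) (fun _ => τ) K} := by

  have key := solvesVortex_mulExp_iff (F := F) (E := E) g φ t τ u hu hΔ
  have hu' : ContMDiff 𝓘(ℝ, B) 𝓘(ℝ, ℝ) ∞ (fun x => -u x) := contDiff_neg.contMDiff.comp hu
  have hbij : Set.BijOn (fun H : HermitianMetric B F E => H.mulExp u hu)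
      {H | SolvesVortex g φ t H}
      {K | SolvesVortex g (twistSection u φ) (fun _ => τ) K} := by
    refine Set.BijOn.mk (fun H hH => (key H).2 hH) ?_ ?_
    · intro H _ K _ hHK
      have h := congrArg (fun G : HermitianMetric B F E => G.mulExp (fun x => -u x) hu') hHK
      simpa [HermitianMetric.mulExp_mulExp_of_add_eq_zero] using h
    · intro K hK
      have h : (K.mulExp (fun x => -u x) hu').mulExp u hu = K :=
        K.mulExp_mulExp_of_add_eq_zero hu' hu (by simp)
      refine ⟨K.mulExp (fun x => -u x) hu', (key _).1 ?_, h⟩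
      rw [h]
      exact hK
  refine ⟨⟨fun ⟨H, hH⟩ => ⟨_, hbij.mapsTo hH⟩, fun ⟨K, hK⟩ => ?_⟩, hbij⟩
  obtain ⟨H, hH, -⟩ := hbij.surjOn hK
  exact ⟨H, hH⟩
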